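/- An overpartition $\lambda$ of an integer $n\ge 0$ is a non-increasing sequence of positive integers with sum $n$ in which the first occurrence of each integer may be overlined (for $n=0$ there is exactly one, the empty one). For an overpartition $\lambda$ and an integer $l\ge 0$, let $f_l(\lambda)$ and $f_{\overline{l}}(\lambda)$ denote the number of non-overlined, respectively overlined, occurrences of $l$ in $\lambda$, and let $V_\lambda(l)$ denote the number of overlined parts of $\lambda$ that are less than or equal to $l$. **Theorem.** Let $k\ge 2$ and $k\ge i\ge 1$ be integers. For $n\ge 0$, let $D_{k,i}(n)$ denote the number of overpartitions $\lambda$ of $n$ such that (i) $f_1(\lambda)\le i-1$; (ii) $f_l(\lambda)+f_{\overline{l}}(\lambda)+f_{l+1}(\lambda)\le k-1$ for every integer $l\ge 0$; and (iii) for every integer $l\ge 0$, if $f_l(\lambda)+f_{\overline{l}}(\lambda)+f_{l+1}(\lambda)=k-1$, then $l f_l(\lambda)+l f_{\overline{l}}(\lambda)+(l+1)f_{l+1}(\lambda)\equiv V_\lambda(l)+i-1 \pmod 2$. Let $C_{k,i}(n)$ denote the number of overpartitions of $n$ whose non-overlined parts are not congruent to $0$, $i$ or $-i$ modulo $2k-1$.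 Then $$C_{k,i}(n)=D_{k,i}(n)\qquad\text{for all } n\ge 0.$$ -/

import Mathlib

/-- An overpartition of `n`: a partition of `n` together with the set of those part sizes whose
first occurrence is overlined (each part size that occurs may have its first occurrence, and
only that one, overlined). -/
@[ext]
structure Overpartition (n : ℕ) where
  /-- the underlying partition of `n` -/
  toPartition : Nat.Partition n
  /-- the sizes of the overlined parts -/
  overlined : Finset ℕ
  overlined_mem : ∀ l ∈ overlined, l ∈ toPartition.parts

namespace Overpartition

variable {n : ℕ}

/-- The number of overlined occurrences of `l`; it is `0` or `1`. -/
def fOver (lam : Overpartition n) (l : ℕ) : ℕ :=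
  if l ∈ lam.overlined then 1 else 0

/-- The number of non-overlined occurrences of `l`: all occurrences but the overlined one. -/
def fNon (lam : Overpartition n) (l : ℕ) : ℕ :=
  lam.toPartition.parts.count l - lam.fOver l

/-- The subtraction in `fNon` never truncates. -/
theorem fNon_add_fOver (lam : Overpartition n) (l : ℕ) :
    lam.fNon l + lam.fOver l = lam.toPartition.parts.count l := by
  unfold fNon
  apply Nat.sub_add_cancel
  unfold fOver
  split_ifs with h
  · exact Multiset.one_le_count_iff_mem.mpr (lam.overlined_mem l h)
  · exact Nat.zero_le _

/-- The number `V(l)` of overlined parts that are less than or equal to `l`. -/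
def V (lam : Overpartition n) (l : ℕ) : ℕ :=
  (lam.overlined.filter (fun m => m ≤ l)).card

/-- No non-overlined part is congruent to `0`, `i` or `-i` modulo `2k - 1`. -/
def IsC (k i : ℕ) (lam : Overpartition n) : Prop :=
  ∀ l : ℕ, 0 < lam.fNon l →
    ¬ (l : ℤ) ≡ 0 [ZMOD 2 * (k : ℤ) - 1] ∧
    ¬ (l : ℤ) ≡ (i : ℤ) [ZMOD 2 * (k : ℤ) - 1] ∧
    ¬ (l : ℤ) ≡ -(i : ℤ) [ZMOD 2 * (k : ℤ) - 1]

/-- The three frequency and parity conditions (used for `1 ≤ i ≤ k`). -/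
def IsD (k i : ℕ) (lam : Overpartition n) : Prop :=
  lam.fNon 1 ≤ i - 1 ∧
  (∀ l : ℕ, lam.fNon l + lam.fOver l + lam.fNon (l + 1) ≤ k - 1) ∧
  (∀ l : ℕ, lam.fNon l + lam.fOver l + lam.fNon (l + 1) = k - 1 →
    l * lam.fNon l + l * lam.fOver l + (l + 1) * lam.fNon (l + 1)
      ≡ lam.V l + (i - 1) [MOD 2])

/-- There are finitely many overpartitions of `n`, so that the cardinalities below are genuine. -/
instance finite (n : ℕ) : Finite (Overpartition n) := by
  refine Finite.of_injective
    (β := Σ p : Nat.Partition n, {s : Finset ℕ // s ∈ p.parts.toFinset.powerset})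
    (fun lam => ⟨lam.toPartition, lam.overlined, Finset.mem_powerset.mpr
      (fun l hl => Multiset.mem_toFinset.mpr (lam.overlined_mem l hl))⟩) ?_
  rintro ⟨p, s, hs⟩ ⟨q, t, ht⟩ h
  simp only [Sigma.mk.injEq] at h
  obtain ⟨rfl, h⟩ := h
  have h2 := eq_of_heq h
  simp only [Subtype.mk.injEq] at h2
  subst h2
  rfl

end Overpartition

/-- `C_{k,i}(n)`. -/
noncomputable def countC (k i n : ℕ) : ℕ :=
  Nat.card {lam : Overpartition n // lam.IsC k i}

/-- `D_{k,i}(n)`. -/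
noncomputable def countD (k i n : ℕ) : ℕ :=
  Nat.card {lam : Overpartition n // lam.IsD k i}

open PowerSeries

/-! Put `k = κ + 1` and peel off the parts of size `s + 1`, for `s = 0, 1, ...`. If such a part
occurs `i - 1` or `i - 2` times without overline, and `e` times overlined, the frequency and parity
conditions at `s + 1` together say exactly that `s + 2` occurs fewer than `κ + 2 - i - e` times
without overline (`freqCond_attach_self_iff`). The series `seriesD κ s i` of the remaining tails
therefore satisfy the recurrences `seriesD_add_two` and `seriesD_one`, which link level `s` to level
`s + 1`.

The alternating sums `gordonSum` satisfy the same recurrences after normalization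
(`gordonSum_add_two`, `gordonSum_one`). Since tails with large parts have series close to `1`, the
recurrences have only one solution, so `seriesD κ s i` is `(-q^(s+1); q)_∞ / (q; q)_∞` times the
limit of `gordonSum` at `s`. For `s = 0` that limit is a theta series, which the Jacobi triple
product turns into the product of `1 - q^t` over `t ≡ 0, ±i` modulo `2κ + 1`. The result is the
product for overpartitions without non-overlined parts in these classes.

No limits are taken: for a given size `N` everything is computed modulo `X^(N+1)`. There series and
sums become explicit (`map_seriesD`, `map_seriesC`), remainders vanish, and a finite triple product
suffices (`finite_tripleProduct`, `tripleProduct_dvd`). -/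

/-- An overpartition of unspecified size: its multiset of non-overlined parts together with its
set of overlined parts. -/
abbrev OverPair := Multiset ℕ × Finset ℕ

/-! ### Overpartitions of arbitrary size and their generating series. -/

namespace OverPair

/-- The sum of all parts. -/
def size (x : OverPair) : ℕ := x.1.sum + ∑ l ∈ x.2, l

/-- All parts are greater than `s`. -/
def PartsGT (s : ℕ) (x : OverPair) : Prop := (∀ l ∈ x.1, s < l) ∧ ∀ l ∈ x.2, s < l

/-- Add `j` non-overlined copies of `a` and, if `e` is true, an overlined one. -/
def attach (a j : ℕ) (e : Bool) (x : OverPair) : OverPair :=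
  (Multiset.replicate j a + x.1, if e then insert a x.2 else x.2)

/-- Delete all parts equal to `a`. -/
def detach (a : ℕ) (x : OverPair) : OverPair := (x.1.filter (· ≠ a), x.2.erase a)

theorem PartsGT.mono {s t : ℕ} {x : OverPair} (h : PartsGT t x) (hst : s ≤ t) : PartsGT s x :=
  ⟨fun l hl => hst.trans_lt (h.1 l hl), fun l hl => hst.trans_lt (h.2 l hl)⟩

theorem PartsGT.count_eq_zero {s l : ℕ} {x : OverPair} (h : PartsGT s x) (hl : l ≤ s) :
    x.1.count l = 0 :=
  Multiset.count_eq_zero.mpr fun hm => absurd (h.1 l hm) (by omega)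

theorem PartsGT.notMem {s l : ℕ} {x : OverPair} (h : PartsGT s x) (hl : l ≤ s) : l ∉ x.2 :=
  fun hm => absurd (h.2 l hm) (by omega)

theorem PartsGT.attach {s j : ℕ} {e : Bool} {x : OverPair} (h : PartsGT (s + 1) x) :
    PartsGT s (attach (s + 1) j e x) := by
  refine ⟨fun l hl => ?_, fun l hl => ?_⟩
  · rcases Multiset.mem_add.mp hl with hl | hl
    · have := Multiset.eq_of_mem_replicate hl; omega
    · have := h.1 l hl; omega
  · cases e
    · have := h.2 l hl; omega
    · rcases Finset.mem_insert.mp hl with hl | hl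
      · omega
      · have := h.2 l hl; omega

theorem PartsGT.detach {s : ℕ} {x : OverPair} (h : PartsGT s x) :
    PartsGT (s + 1) (detach (s + 1) x) := by
  refine ⟨fun l hl => ?_, fun l hl => ?_⟩
  · obtain ⟨hl, hne⟩ := Multiset.mem_filter.mp hl
    have := h.1 l hl; omega
  · obtain ⟨hne, hl⟩ := Finset.mem_erase.mp hl
    have := h.2 l hl; omega

theorem size_attach {a j : ℕ} {e : Bool} {x : OverPair} (ha : a ∉ x.2) :
    size (attach a j e x) = size x + a * (j + e.toNat) := by
  cases e <;> simp [size, attach, ha] <;> ring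

theorem attach_detach {a : ℕ} {e : Bool} {x : OverPair} (he : a ∈ x.2 ↔ e = true) :
    attach a (x.1.count a) e (detach a x) = x := by
  refine Prod.ext ?_ ?_
  · ext l
    by_cases h : l = a
    · subst h; simp [attach, detach]
    · simp [attach, detach, Multiset.count_replicate, h, Ne.symm h]
  · cases e
    · simpa [attach, detach] using he
    · exact Finset.insert_erase (he.mpr rfl)

theorem detach_attach {a j : ℕ} {e : Bool} {x : OverPair} (h1 : a ∉ x.1) (h2 : a ∉ x.2) :
    detach a (attach a j e x) = x := by
  refine Prod.ext ?_ ?_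
  · simp only [attach, detach, Multiset.filter_add]
    rw [Multiset.filter_eq_nil.mpr, Multiset.filter_eq_self.mpr, zero_add]
    · rintro l hl rfl; exact h1 hl
    · intro l hl; simp [Multiset.eq_of_mem_replicate hl]
  · cases e <;> simp [attach, detach, h2]

theorem count_attach {a j l : ℕ} {e : Bool} {x : OverPair} :
    (attach a j e x).1.count l = (if l = a then j else 0) + x.1.count l := by
  simp [attach, Multiset.count_replicate, eq_comm]

theorem mem_attach {a j l : ℕ} {e : Bool} {x : OverPair} :
    l ∈ (attach a j e x).2 ↔ (l = a ∧ e = true) ∨ l ∈ x.2 := by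
  cases e <;> simp [attach]

theorem PartsGT.eq_zero_or_lt_size {s : ℕ} {x : OverPair} (h : PartsGT s x) :
    x = (0, ∅) ∨ s < size x := by
  obtain ⟨M, S⟩ := x
  rcases Multiset.empty_or_exists_mem M with rfl | ⟨l, hl⟩
  · rcases S.eq_empty_or_nonempty with rfl | ⟨l, hl⟩
    · exact Or.inl rfl
    · right
      have h1 := h.2 l hl
      have h2 : l ≤ ∑ l ∈ S, l := Finset.single_le_sum (f := fun l => l) (fun _ _ => Nat.zero_le _) hl
      simp only [size]; omega
  · right
    have h1 := h.1 l hl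
    have h2 := Multiset.single_le_sum (fun x _ => Nat.zero_le x) l hl
    simp only [size]; omega

/-- The multiset of non-overlined parts and the set of overlined parts of an overpartition. -/
def ofOverpartition {n : ℕ} (lam : Overpartition n) : OverPair :=
  (lam.toPartition.parts - lam.overlined.val, lam.overlined)

section
variable {n : ℕ} (lam : Overpartition n)

theorem overlined_val_le : lam.overlined.val ≤ lam.toPartition.parts :=
  (Multiset.le_iff_subset lam.overlined.nodup).mpr lam.overlined_mem

theorem ofOverpartition_count (l : ℕ) : (ofOverpartition lam).1.count l = lam.fNon l := by
  simp only [ofOverpartition, Multiset.count_sub, Overpartition.fNon, Overpartition.fOver,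
    Multiset.count_eq_of_nodup lam.overlined.nodup, Finset.mem_val]

theorem ofOverpartition_injective : Function.Injective (ofOverpartition (n := n)) := by
  intro lam mu h
  obtain ⟨h1, h2⟩ := Prod.ext_iff.mp h
  simp only [ofOverpartition] at h1 h2
  refine Overpartition.ext ?_ h2
  refine Nat.Partition.ext ?_
  rw [← Multiset.sub_add_cancel (overlined_val_le lam),
    ← Multiset.sub_add_cancel (overlined_val_le mu), h1, h2]

theorem ofOverpartition_partsGT : PartsGT 0 (ofOverpartition lam) :=
  ⟨fun _ hl => lam.toPartition.parts_pos (Multiset.mem_of_le (Multiset.sub_le_self _ _) hl),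
    fun l hl => lam.toPartition.parts_pos (lam.overlined_mem l hl)⟩

theorem size_ofOverpartition : size (ofOverpartition lam) = n := by
  have h : (lam.toPartition.parts - lam.overlined.val).sum + lam.overlined.val.sum = n := by
    rw [← Multiset.sum_add, Multiset.sub_add_cancel (overlined_val_le lam),
      lam.toPartition.parts_sum]
  have h2 : ∑ l ∈ lam.overlined, l = lam.overlined.val.sum := (Finset.sum_val _).symm
  rw [size, ofOverpartition, h2, h]

end

theorem exists_ofOverpartition_eq {n : ℕ} {x : OverPair} (h : PartsGT 0 x) (hn : size x = n) :
    ∃ lam : Overpartition n, ofOverpartition lam = x := by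
  refine ⟨⟨⟨x.1 + x.2.val, fun {l} hl => ?_, ?_⟩, x.2, fun l hl => ?_⟩, ?_⟩
  · rcases Multiset.mem_add.mp hl with hl | hl
    · exact h.1 l hl
    · exact h.2 l hl
  · rw [← hn, size, Multiset.sum_add, Finset.sum_val]; rfl
  · exact Multiset.mem_add.mpr (Or.inr hl)
  · simp [ofOverpartition]

theorem finite_size_eq {P : OverPair → Prop} (hP : ∀ x, P x → PartsGT 0 x) (n : ℕ) :
    {x | P x ∧ size x = n}.Finite := by
  refine (Set.finite_range (ofOverpartition (n := n))).subset ?_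
  rintro x ⟨hx, hn⟩
  exact exists_ofOverpartition_eq (hP x hx) hn

/-- The generating series by size of the pairs satisfying `P`. -/
noncomputable def series (P : OverPair → Prop) : ℤ⟦X⟧ :=
  PowerSeries.mk fun n => ({x | P x ∧ size x = n}.ncard : ℤ)

theorem coeff_series_eq_card {n : ℕ} {P : OverPair → Prop} {Q : Overpartition n → Prop}
    (hP : ∀ x, P x → PartsGT 0 x) (hPQ : ∀ lam, Q lam ↔ P (ofOverpartition lam)) :
    coeff n (series P) = Nat.card {lam // Q lam} := by
  have h : {x | P x ∧ size x = n} = ofOverpartition '' {lam : Overpartition n | Q lam} := by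
    ext x
    constructor
    · rintro ⟨hx, hn⟩
      obtain ⟨lam, rfl⟩ := exists_ofOverpartition_eq (hP x hx) hn
      exact ⟨lam, (hPQ lam).mpr hx, rfl⟩
    · rintro ⟨lam, hl, rfl⟩
      exact ⟨(hPQ lam).mp hl, size_ofOverpartition lam⟩
  rw [series, coeff_mk, h, Set.ncard_image_of_injective _ ofOverpartition_injective]
  rfl

theorem series_or {P Q : OverPair → Prop} (hP : ∀ x, P x → PartsGT 0 x)
    (hQ : ∀ x, Q x → PartsGT 0 x) (hPQ : ∀ x, P x → ¬ Q x) :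
    series (fun x => P x ∨ Q x) = series P + series Q := by
  ext n
  have h : {x | (P x ∨ Q x) ∧ size x = n} = {x | P x ∧ size x = n} ∪ {x | Q x ∧ size x = n} := by
    ext x; simp only [Set.mem_ofPred_eq, Set.mem_union]; tauto
  rw [map_add, series, series, series, coeff_mk, coeff_mk, coeff_mk, h,
    Set.ncard_union_eq _ (finite_size_eq hP n) (finite_size_eq hQ n), Nat.cast_add]
  exact Set.disjoint_left.mpr fun x hx hx' => hPQ x hx.1 hx'.1

theorem series_eq_zero {P : OverPair → Prop} (hP : ∀ x, ¬ P x) : series P = 0 := by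
  ext n; simp [series, hP]

/-- A bijection raising the size by `d` multiplies the series by `X ^ d`. -/
theorem series_eq_X_pow_mul {P Q : OverPair → Prop} {d : ℕ} (f g : OverPair → OverPair)
    (hf : ∀ x, Q x → P (f x)) (hg : ∀ x, P x → Q (g x)) (hfg : ∀ x, P x → f (g x) = x)
    (hgf : ∀ x, Q x → g (f x) = x) (hsize : ∀ x, Q x → size (f x) = size x + d) :
    series P = X ^ d * series Q := by
  ext n
  rw [coeff_X_pow_mul']
  split_ifs with hd
  · rw [series, series, coeff_mk, coeff_mk, Nat.cast_inj]
    refine (Set.ncard_congr (fun x _ => f x) ?_ ?_ ?_).symm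
    · rintro x ⟨hx, hn⟩
      exact ⟨hf x hx, by rw [hsize x hx, hn]; omega⟩
    · rintro x y ⟨hx, -⟩ ⟨hy, -⟩ h
      rw [← hgf x hx, ← hgf y hy, h]
    · rintro x ⟨hx, hn⟩
      have := hsize _ (hg x hx)
      rw [hfg x hx] at this
      exact ⟨g x, ⟨hg x hx, by omega⟩, hfg x hx⟩
  · rw [series, coeff_mk, Nat.cast_eq_zero]
    convert Set.ncard_empty OverPair
    refine Set.eq_empty_of_forall_notMem ?_
    rintro x ⟨hx, hn⟩
    have := hsize _ (hg x hx)
    rw [hfg x hx] at this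
    omega

/-- Only the empty pair has size at most `s`. This is the starting point of both downward inductions
on `s`. -/
theorem X_pow_dvd_series_sub_one {P : OverPair → Prop} {s : ℕ} (hP : ∀ x, P x → PartsGT s x)
    (h0 : P (0, ∅)) : X ^ (s + 1) ∣ series P - 1 := by
  rw [X_pow_dvd_iff]
  intro n hn
  rw [map_sub, series, coeff_mk, coeff_one, sub_eq_zero]
  split_ifs with h
  · subst h
    rw [Nat.cast_eq_one, Set.ncard_eq_one]
    refine ⟨(0, ∅), Set.eq_singleton_iff_unique_mem.mpr ⟨⟨h0, rfl⟩, ?_⟩⟩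
    rintro x ⟨hx, hx0⟩
    exact (hP x hx).eq_zero_or_lt_size.resolve_right (by omega)
  · rw [Nat.cast_eq_zero]
    convert Set.ncard_empty OverPair
    refine Set.eq_empty_of_forall_notMem ?_
    rintro x ⟨hx, hxn⟩
    rcases (hP x hx).eq_zero_or_lt_size with rfl | h'
    · exact h hxn.symm
    · omega

end OverPair

/-! ### Recurrences for the series of the frequency and parity conditions. -/

namespace OverPair

/-- The number of overlined occurrences of `l`. -/
def bar (x : OverPair) (l : ℕ) : ℕ := if l ∈ x.2 then 1 else 0

/-- The frequency and parity condition at `l`, with parity offset `p`. -/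
def FreqCond (κ p : ℕ) (x : OverPair) (l : ℕ) : Prop :=
  x.1.count l + bar x l + x.1.count (l + 1) ≤ κ ∧
  (x.1.count l + bar x l + x.1.count (l + 1) = κ →
    l * (x.1.count l + bar x l) + (l + 1) * x.1.count (l + 1)
      ≡ (x.2.filter (fun m => m ≤ l)).card + p [MOD 2])

/-- The conditions of `Overpartition.IsD` for `k = κ + 1`, restricted to parts greater than `s`. -/
def IsDTail (κ s i : ℕ) (x : OverPair) : Prop :=
  PartsGT s x ∧ x.1.count (s + 1) < i ∧ ∀ l, s < l → FreqCond κ (i + 1 + s * κ) x l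

theorem bar_attach {a j l : ℕ} {e : Bool} {x : OverPair} (ha : a ∉ x.2) :
    bar (attach a j e x) l = (if l = a then e.toNat else 0) + bar x l := by
  unfold bar
  by_cases h : l = a
  · subst h; cases e <;> simp [mem_attach, ha]
  · simp [mem_attach, h]

theorem card_filter_attach {a j l : ℕ} {e : Bool} {x : OverPair} (ha : a ∉ x.2) (hl : a ≤ l) :
    ((attach a j e x).2.filter (fun m => m ≤ l)).card
      = e.toNat + (x.2.filter (fun m => m ≤ l)).card := by
  cases e
  · simp [attach]
  · simp [attach, Finset.filter_insert, hl, ha, add_comm]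

theorem FreqCond.congr {κ p p' l : ℕ} {x : OverPair} (h : p ≡ p' [MOD 2]) :
    FreqCond κ p x l ↔ FreqCond κ p' x l := by
  have := Nat.ModEq.add_left (x.2.filter (fun m => m ≤ l)).card h
  exact and_congr_right fun _ => imp_congr_right fun _ => ⟨(·.trans this), (·.trans this.symm)⟩

theorem freqCond_attach_of_lt {κ p a j l : ℕ} {e : Bool} {x : OverPair} (ha : a ∉ x.2)
    (hl : a < l) :
    FreqCond κ p (attach a j e x) l ↔ FreqCond κ (p + e.toNat) x l := by
  have h1 : l ≠ a := by omega
  have h2 : l + 1 ≠ a := by omega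
  simp only [FreqCond, count_attach, bar_attach ha, card_filter_attach ha hl.le, if_neg h1,
    if_neg h2, zero_add]
  rw [add_comm e.toNat, add_assoc _ e.toNat, add_comm e.toNat]

theorem freqCond_attach_self {κ p a j : ℕ} {e : Bool} {x : OverPair} (hx : PartsGT a x) :
    FreqCond κ p (attach a j e x) a ↔
      j + e.toNat + x.1.count (a + 1) ≤ κ ∧
      (j + e.toNat + x.1.count (a + 1) = κ →
        a * (j + e.toNat) + (a + 1) * x.1.count (a + 1) ≡ e.toNat + p [MOD 2]) := by
  have h2 : a + 1 ≠ a := by omega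
  have h3 : x.2.filter (fun m => m ≤ a) = ∅ := by
    refine Finset.filter_eq_empty_iff.mpr fun l hl => ?_
    have := hx.2 l hl
    omega
  have h4 : bar x a = 0 := if_neg (hx.notMem le_rfl)
  simp only [FreqCond, count_attach, bar_attach (hx.notMem le_rfl),
    card_filter_attach (hx.notMem le_rfl) le_rfl, if_neg h2, h3, h4,
    hx.count_eq_zero le_rfl, if_true, Finset.card_empty, add_zero, zero_add]

/-- For `j = i - 1` the frequency bound alone gives `c < i'`. For `j = i - 2` it gives only `c ≤
i'`, and the parity condition excludes equality. -/
theorem freqCond_attach_self_iff {κ s i j i' : ℕ} {e : Bool} {x : OverPair}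
    (hx : PartsGT (s + 1) x) (hi' : i' + e.toNat + i = κ + 2) (hj : j + 1 = i ∨ j + 2 = i) :
    FreqCond κ (i + 1 + s * κ) (attach (s + 1) j e x) (s + 1) ↔ x.1.count (s + 1 + 1) < i' := by
  rw [freqCond_attach_self hx]
  set c := x.1.count (s + 1 + 1)
  generalize e.toNat = b at *
  -- When the total is `κ`, both sides contain `s * κ`; what is left compares `j + b` with `b + i +
  -- 1` modulo 2, which separates `i - 1` from `i - 2`.
  have key : j + b + c = κ →
      ((s + 1) * (j + b) + (s + 1 + 1) * c ≡ b + (i + 1 + s * κ) [MOD 2] ↔ j + 1 = i) := by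
    rintro rfl
    have e1 : (s + 1) * (j + b) + (s + 1 + 1) * c = s * (j + b + c) + (j + b + 2 * c) := by ring
    have e2 : b + (i + 1 + s * (j + b + c)) = s * (j + b + c) + (b + i + 1) := by ring
    rw [e1, e2]
    constructor
    · intro h
      have := Nat.ModEq.add_left_cancel' _ h
      unfold Nat.ModEq at this
      omega
    · intro h
      refine Nat.ModEq.add_left _ ?_
      unfold Nat.ModEq
      omega
  constructor
  · rintro ⟨h1, h2⟩
    by_cases h3 : j + b + c = κ
    · have := (key h3).mp (h2 h3)
      omega
    · omega
  · intro h
    exact ⟨by omega, fun h3 => (key h3).mpr (by omega)⟩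

/-- The offset `i + 1 + s * κ` in `IsDTail` is chosen to make this step consistent: an overlined `s
+ 1` adds `e` to the count of smaller overlined parts, and `i' + 1 + κ` has the parity of `i + 1 +
e`. -/
theorem isDTail_attach_iff {κ s i j i' : ℕ} {e : Bool} {x : OverPair}
    (hx : PartsGT (s + 1) x) (hi' : i' + e.toNat + i = κ + 2) (hj : j + 1 = i ∨ j + 2 = i) :
    IsDTail κ s i (attach (s + 1) j e x) ↔ IsDTail κ (s + 1) i' x := by
  have h1 : (attach (s + 1) j e x).1.count (s + 1) < i := by
    rw [count_attach, if_pos rfl, hx.count_eq_zero le_rfl]; omega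
  have hp : i + 1 + s * κ + e.toNat ≡ i' + 1 + (s + 1) * κ [MOD 2] := by
    have e1 : i' + 1 + (s + 1) * κ = s * κ + (i' + 1 + κ) := by ring
    rw [e1, show i + 1 + s * κ + e.toNat = s * κ + (i + 1 + e.toNat) by ring]
    refine Nat.ModEq.add_left _ ?_
    unfold Nat.ModEq
    omega
  have hlt : ∀ l, s + 1 < l → (FreqCond κ (i + 1 + s * κ) (attach (s + 1) j e x) l ↔
      FreqCond κ (i' + 1 + (s + 1) * κ) x l) := fun l hl => by
    rw [freqCond_attach_of_lt (hx.notMem le_rfl) hl, FreqCond.congr hp]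
  constructor
  · rintro ⟨-, -, h⟩
    exact ⟨hx, (freqCond_attach_self_iff hx hi' hj).mp (h _ (Nat.lt_succ_self s)),
      fun l hl => (hlt l hl).mp (h l (by omega))⟩
  · rintro ⟨-, h2, h⟩
    refine ⟨hx.attach, h1, fun l hl => ?_⟩
    rcases Nat.eq_or_lt_of_le (Nat.succ_le_of_lt hl) with rfl | hl
    · exact (freqCond_attach_self_iff hx hi' hj).mpr h2
    · exact (hlt l hl).mpr (h l hl)

/-- The pairs in `IsDTail κ s i` with exactly `j` non-overlined parts `s + 1`, and in which
`s + 1` is overlined just when `e` is true. -/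
def IsDClass (κ s i j : ℕ) (e : Bool) (x : OverPair) : Prop :=
  IsDTail κ s i x ∧ x.1.count (s + 1) = j ∧ (s + 1 ∈ x.2 ↔ e = true)

theorem series_isDClass {κ s i j i' : ℕ} {e : Bool}
    (hi' : i' + e.toNat + i = κ + 2) (hj : j + 1 = i ∨ j + 2 = i) :
    series (IsDClass κ s i j e)
      = X ^ ((s + 1) * (j + e.toNat)) * series (IsDTail κ (s + 1) i') := by
  have hback : ∀ x, IsDClass κ s i j e x → attach (s + 1) j e (detach (s + 1) x) = x := by
    rintro x ⟨-, rfl, he⟩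
    exact attach_detach he
  refine series_eq_X_pow_mul (attach (s + 1) j e) (detach (s + 1)) ?_ ?_ hback ?_ ?_
  · intro x hx
    refine ⟨(isDTail_attach_iff hx.1 hi' hj).mpr hx, ?_, ?_⟩
    · rw [count_attach, if_pos rfl, hx.1.count_eq_zero le_rfl, add_zero]
    · simp [mem_attach, hx.1.notMem le_rfl]
  · intro x hx
    rw [← isDTail_attach_iff hx.1.1.detach hi' hj, hback x hx]
    exact hx.1
  · intro x hx
    exact detach_attach (fun h => absurd (hx.1.1 _ h) (lt_irrefl _)) (hx.1.notMem le_rfl)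
  · intro x hx
    exact size_attach (hx.1.notMem le_rfl)

/-- The generating series of `IsDTail`. -/
noncomputable def seriesD (κ s i : ℕ) : ℤ⟦X⟧ := series (IsDTail κ s i)

theorem isDTail_partsGT {κ s i : ℕ} (x : OverPair) (h : IsDTail κ s i x) : PartsGT 0 x :=
  h.1.mono (Nat.zero_le _)

/-- The pairs in `IsDTail κ s i` with exactly `j` non-overlined parts `s + 1`. -/
theorem series_isDTail_count_eq {κ s i j d : ℕ} (hd : d + i = κ + 1)
    (hj : j + 1 = i ∨ j + 2 = i) :
    series (fun x => IsDTail κ s i x ∧ x.1.count (s + 1) = j)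
      = X ^ ((s + 1) * j) *
        (seriesD κ (s + 1) (d + 1) + X ^ (s + 1) * seriesD κ (s + 1) d) := by
  have h : (fun x => IsDTail κ s i x ∧ x.1.count (s + 1) = j)
      = fun x => IsDClass κ s i j false x ∨ IsDClass κ s i j true x := by
    funext x
    simp only [IsDClass, eq_iff_iff]
    by_cases hx : s + 1 ∈ x.2 <;> simp [hx]
  rw [h, series_or (fun x hx => isDTail_partsGT x hx.1) (fun x hx => isDTail_partsGT x hx.1),
    series_isDClass (i' := d + 1) (by simp; omega) hj,
    series_isDClass (i' := d) (by simp; omega) hj]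
  · simp only [seriesD, Bool.toNat_false, Bool.toNat_true]; ring
  · rintro x ⟨-, -, h1⟩ ⟨-, -, h2⟩
    simp_all

/-- The offsets for `a` and `a + 2` agree modulo 2, so the tails with fewer than `a` plain copies of
`s + 1` are those counted for `a`. Multiplicities `a` and `a + 1` lead to the same next level,
whence the factor `1 + X ^ (s + 1)`. -/
theorem seriesD_add_two {κ s a d : ℕ} (hd : d + (a + 2) = κ + 1) :
    seriesD κ s (a + 2) = seriesD κ s a + X ^ ((s + 1) * a) * (1 + X ^ (s + 1)) *
      (seriesD κ (s + 1) (d + 1) + X ^ (s + 1) * seriesD κ (s + 1) d) := by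
  have hpar : a + 1 + s * κ ≡ a + 2 + 1 + s * κ [MOD 2] := by
    refine Nat.ModEq.add_right _ ?_
    unfold Nat.ModEq
    omega
  have h : IsDTail κ s (a + 2) = fun x => IsDTail κ s a x ∨
      ((IsDTail κ s (a + 2) x ∧ x.1.count (s + 1) = a) ∨
        (IsDTail κ s (a + 2) x ∧ x.1.count (s + 1) = a + 1)) := by
    funext x
    simp only [IsDTail, eq_iff_iff, FreqCond.congr hpar]
    constructor
    · rintro ⟨h1, h2, h3⟩
      have h4 : x.1.count (s + 1) < a ∨ x.1.count (s + 1) = a ∨ x.1.count (s + 1) = a + 1 := by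
        omega
      tauto
    · rintro (⟨h1, h2, h3⟩ | ⟨h, -⟩ | ⟨h, -⟩)
      · exact ⟨h1, by omega, h3⟩
      · exact h
      · exact h
  conv_lhs => rw [seriesD, h]
  rw [series_or isDTail_partsGT, series_or (fun x hx => isDTail_partsGT x hx.1)
    (fun x hx => isDTail_partsGT x hx.1), series_isDTail_count_eq hd (Or.inr rfl),
    series_isDTail_count_eq hd (Or.inl rfl)]
  · simp only [seriesD]; ring
  · rintro x ⟨-, h1⟩ ⟨-, h2⟩
    omega
  · rintro x (⟨h1, -⟩ | ⟨h1, -⟩) <;> exact isDTail_partsGT x h1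
  · rintro x ⟨-, h1, -⟩ (⟨-, h2⟩ | ⟨-, h2⟩) <;> omega

theorem seriesD_one {κ s : ℕ} :
    seriesD κ s 1 = seriesD κ (s + 1) (κ + 1) + X ^ (s + 1) * seriesD κ (s + 1) κ := by
  have h : IsDTail κ s 1 = fun x => IsDTail κ s 1 x ∧ x.1.count (s + 1) = 0 := by
    funext x
    refine eq_iff_iff.mpr ⟨fun h => ⟨h, ?_⟩, fun h => h.1⟩
    have := h.2.1
    omega
  conv_lhs => rw [seriesD, h]
  rw [series_isDTail_count_eq (d := κ) rfl (Or.inl rfl), Nat.mul_zero, pow_zero, one_mul]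

theorem seriesD_zero {κ s : ℕ} : seriesD κ s 0 = 0 :=
  series_eq_zero fun _ h => absurd h.2.1 (Nat.not_lt_zero _)

theorem X_pow_dvd_seriesD_sub_one {κ s i : ℕ} (hκ : 0 < κ) (hi : 0 < i) :
    X ^ (s + 1) ∣ seriesD κ s i - 1 := by
  refine X_pow_dvd_series_sub_one (fun x hx => hx.1) ⟨by simp [PartsGT], by simpa using hi, ?_⟩
  intro l _
  simp [FreqCond, bar, hκ.ne]

theorem countD_eq_coeff {κ i n : ℕ} (hi : 1 ≤ i) (hik : i ≤ κ + 1) :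
    (countD (κ + 1) i n : ℤ) = coeff n (seriesD κ 0 i) := by
  rw [countD, seriesD, coeff_series_eq_card isDTail_partsGT]
  intro lam
  have hbar : ∀ l, bar (ofOverpartition lam) l = lam.fOver l := fun l => rfl
  have hV : ∀ l, ((ofOverpartition lam).2.filter (fun m => m ≤ l)).card = lam.V l := fun l => rfl
  have hpar : ∀ l, lam.V l + (i - 1) ≡ lam.V l + (i + 1 + 0 * κ) [MOD 2] := fun l => by
    refine Nat.ModEq.add_left _ ?_
    unfold Nat.ModEq
    omega
  simp only [Overpartition.IsD, IsDTail, FreqCond, ofOverpartition_count, hbar, hV, mul_add,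
    Nat.add_sub_cancel]
  have h01 : lam.fNon (0 + 1) = lam.fNon 1 := rfl
  constructor
  · rintro ⟨h1, h2, h3⟩
    exact ⟨ofOverpartition_partsGT lam, by omega,
      fun l _ => ⟨h2 l, fun h => (h3 l h).trans (hpar l)⟩⟩
  · rintro ⟨-, h1, h⟩
    have h0 : lam.fNon 0 = 0 := by
      rw [← ofOverpartition_count]; exact (ofOverpartition_partsGT lam).count_eq_zero le_rfl
    have h0' : lam.fOver 0 = 0 := if_neg ((ofOverpartition_partsGT lam).notMem le_rfl)
    have hV0 : lam.V 0 = 0 := by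
      refine Finset.card_eq_zero.mpr (Finset.filter_eq_empty_iff.mpr fun l hl => ?_)
      have := lam.toPartition.parts_pos (lam.overlined_mem l hl)
      omega
    refine ⟨by omega, fun l => ?_, fun l hl => ?_⟩
    · rcases Nat.eq_zero_or_pos l with rfl | hl
      · simp only [h0, h0', zero_add]; omega
      · exact (h l hl).1
    · rcases Nat.eq_zero_or_pos l with rfl | hl'
      · rw [h0, h0', zero_add] at hl
        rw [h0, h0', hV0, zero_add]
        -- At `l = 0`, which `IsDTail` omits, equality forces `fNon 1 = κ`; as `fNon 1 ≤ i - 1 ≤ κ`,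
        -- the parity condition then holds automatically.
        have : lam.fNon 1 = i - 1 := by omega
        simp [this]; rfl
      · exact ((h l hl').2 hl).trans (hpar l).symm

end OverPair

/-! ### Recurrences for the series of the congruence condition. -/

namespace OverPair

/-- All parts are greater than `s` and no non-overlined part satisfies `F`. -/
def AvoidTail (F : ℕ → Prop) (s : ℕ) (x : OverPair) : Prop :=
  PartsGT s x ∧ ∀ l ∈ x.1, ¬ F l

/-- The generating series of `AvoidTail`. -/
noncomputable def seriesC (F : ℕ → Prop) (s : ℕ) : ℤ⟦X⟧ := series (AvoidTail F s)

variable {F : ℕ → Prop} {s : ℕ}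

theorem avoidTail_partsGT (x : OverPair) (h : AvoidTail F s x) : PartsGT 0 x :=
  h.1.mono (Nat.zero_le _)

theorem series_avoidTail_class (e : Bool) :
    series (fun x => AvoidTail F s x ∧ x.1.count (s + 1) = 0 ∧ (s + 1 ∈ x.2 ↔ e = true))
      = X ^ ((s + 1) * e.toNat) * seriesC F (s + 1) := by
  refine series_eq_X_pow_mul (attach (s + 1) 0 e) (detach (s + 1)) ?_ ?_ ?_ ?_ ?_
  · intro x hx
    refine ⟨⟨hx.1.attach, by simpa [attach] using hx.2⟩, ?_, ?_⟩
    · rw [count_attach, if_pos rfl, hx.1.count_eq_zero le_rfl, add_zero]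
    · simp [mem_attach, hx.1.notMem le_rfl]
  · rintro x ⟨hx, -, -⟩
    exact ⟨hx.1.detach, fun l hl => hx.2 l (Multiset.mem_filter.mp hl).1⟩
  · rintro x ⟨hx, h0, he⟩
    conv_lhs => rw [← h0]
    exact attach_detach he
  · intro x hx
    exact detach_attach (fun h => absurd (hx.1.1 _ h) (lt_irrefl _)) (hx.1.notMem le_rfl)
  · intro x hx
    rw [size_attach (hx.1.notMem le_rfl), zero_add]

theorem series_avoidTail_count_eq_zero :
    series (fun x => AvoidTail F s x ∧ x.1.count (s + 1) = 0)
      = (1 + X ^ (s + 1)) * seriesC F (s + 1) := by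
  have h : (fun x => AvoidTail F s x ∧ x.1.count (s + 1) = 0)
      = fun x => (AvoidTail F s x ∧ x.1.count (s + 1) = 0 ∧ (s + 1 ∈ x.2 ↔ false = true)) ∨
        (AvoidTail F s x ∧ x.1.count (s + 1) = 0 ∧ (s + 1 ∈ x.2 ↔ true = true)) := by
    funext x
    by_cases hx : s + 1 ∈ x.2 <;> simp [hx]
  rw [h, series_or (fun x hx => avoidTail_partsGT x hx.1) (fun x hx => avoidTail_partsGT x hx.1),
    series_avoidTail_class, series_avoidTail_class]
  · simp only [Bool.toNat_false, Bool.toNat_true]; ring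
  · rintro x ⟨-, -, h1⟩ ⟨-, -, h2⟩
    simp_all

theorem seriesC_of_pos (hF : F (s + 1)) : seriesC F s = (1 + X ^ (s + 1)) * seriesC F (s + 1) := by
  rw [← series_avoidTail_count_eq_zero, seriesC]
  congr 1
  funext x
  exact eq_iff_iff.mpr ⟨fun h => ⟨h, Multiset.count_eq_zero.mpr fun hm => h.2 _ hm hF⟩,
    fun h => h.1⟩

/-- Removing a single plain copy of `s + 1` maps the pairs containing one bijectively onto all
pairs, so the geometric series is encoded without division. -/
theorem seriesC_of_neg (hF : ¬ F (s + 1)) :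
    (1 - X ^ (s + 1)) * seriesC F s = (1 + X ^ (s + 1)) * seriesC F (s + 1) := by
  have h : AvoidTail F s = fun x => (AvoidTail F s x ∧ x.1.count (s + 1) = 0) ∨
      (AvoidTail F s x ∧ s + 1 ∈ x.1) := by
    funext x
    rw [eq_iff_iff, ← and_or_left, Multiset.count_eq_zero]
    exact (and_iff_left (em' _)).symm
  have h2 : series (fun x => AvoidTail F s x ∧ s + 1 ∈ x.1) = X ^ (s + 1) * seriesC F s := by
    refine series_eq_X_pow_mul (fun x => ((s + 1) ::ₘ x.1, x.2)) (fun x => (x.1.erase (s + 1), x.2))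
      ?_ ?_ ?_ ?_ ?_
    · rintro x ⟨⟨h1, h2⟩, h3⟩
      refine ⟨⟨⟨fun l hl => ?_, h2⟩, fun l hl => ?_⟩, Multiset.mem_cons_self _ _⟩
      · rcases Multiset.mem_cons.mp hl with rfl | hl
        · omega
        · exact h1 l hl
      · rcases Multiset.mem_cons.mp hl with rfl | hl
        · exact hF
        · exact h3 l hl
    · rintro x ⟨⟨⟨h1, h2⟩, h3⟩, -⟩
      exact ⟨⟨fun l hl => h1 l (Multiset.mem_of_mem_erase hl), h2⟩,
        fun l hl => h3 l (Multiset.mem_of_mem_erase hl)⟩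
    · rintro x ⟨-, hx⟩
      exact Prod.ext (Multiset.cons_erase hx) rfl
    · intro x _
      exact Prod.ext (Multiset.erase_cons_head _ _) rfl
    · intro x _
      simp only [size, Multiset.sum_cons]
      ring
  have h3 : seriesC F s = (1 + X ^ (s + 1)) * seriesC F (s + 1) + X ^ (s + 1) * seriesC F s := by
    conv_lhs => rw [seriesC, h]
    rw [series_or (fun x hx => avoidTail_partsGT x hx.1) (fun x hx => avoidTail_partsGT x hx.1),
      series_avoidTail_count_eq_zero, h2]
    rintro x ⟨-, h1⟩ ⟨-, h2⟩
    exact Multiset.count_eq_zero.mp h1 h2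
  linear_combination h3

theorem X_pow_dvd_seriesC_sub_one : X ^ (s + 1) ∣ seriesC F s - 1 :=
  X_pow_dvd_series_sub_one (fun _ hx => hx.1) ⟨by simp [PartsGT], by simp⟩

theorem countC_eq_coeff (k i n : ℕ) :
    (countC k i n : ℤ) = coeff n (seriesC (fun l => (l : ℤ) ≡ 0 [ZMOD 2 * (k : ℤ) - 1] ∨
      (l : ℤ) ≡ (i : ℤ) [ZMOD 2 * (k : ℤ) - 1] ∨ (l : ℤ) ≡ -(i : ℤ) [ZMOD 2 * (k : ℤ) - 1]) 0) := by
  rw [countC, seriesC, coeff_series_eq_card avoidTail_partsGT]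
  intro lam
  simp only [Overpartition.IsC, AvoidTail, ← ofOverpartition_count, Multiset.count_pos, not_or,
    ofOverpartition_partsGT lam, true_and]

end OverPair

/-! ### The alternating sums and their recurrences. -/

section Theta
variable {A : Type*} [CommRing A]

/-- The product of `1 - q ^ j` over `n < j ≤ n + s`. -/
def shiftedPochhammer (q : A) (n s : ℕ) : A := ∏ j ∈ Finset.range s, (1 - q ^ (n + 1 + j))

theorem shiftedPochhammer_succ (q : A) (n s : ℕ) :
    shiftedPochhammer q n (s + 1) = shiftedPochhammer q n s * (1 - q ^ (n + s + 1)) := by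
  rw [shiftedPochhammer, Finset.prod_range_succ, shiftedPochhammer, add_right_comm]

theorem shiftedPochhammer_succ' (q : A) (n s : ℕ) :
    shiftedPochhammer q n (s + 1) = shiftedPochhammer q (n + 1) s * (1 - q ^ (n + 1)) := by
  rw [shiftedPochhammer, Finset.prod_range_succ', shiftedPochhammer, add_zero]
  simp only [add_assoc, add_comm 1]

/-- The general term of the alternating sum `gordonSum`. -/
def gordonTerm (κ : ℕ) (q : A) (s i n : ℕ) : A :=
  (-1) ^ n * (q ^ (s * κ * n + (2 * κ + 1) * n.choose 2 + (2 * κ + 1 - i) * n)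
    - q ^ (s * κ * n + (2 * κ + 1) * (n + 1).choose 2 + (s + n + 1) * i)) *
    shiftedPochhammer q n s

/-- The first `B` terms of the product of `(q; q)_∞` with Andrews' series `J_{κ,i}(0; q ^ s; q)`. -/
def gordonSum (κ : ℕ) (q : A) (B s i : ℕ) : A := ∑ n ∈ Finset.range B, gordonTerm κ q s i n

theorem gordonSum_succ (κ : ℕ) (q : A) (B s i : ℕ) :
    gordonSum κ q (B + 1) s i = gordonSum κ q B s i + gordonTerm κ q s i B :=
  Finset.sum_range_succ _ _

theorem gordonSum_zero (κ : ℕ) (q : A) (B s : ℕ) : gordonSum κ q B s 0 = 0 := by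
  refine Finset.sum_eq_zero fun n _ => ?_
  have h : (n + 1).choose 2 = n + n.choose 2 := by rw [Nat.choose_succ_succ', Nat.choose_one_right]
  rw [gordonTerm, h, Nat.sub_zero, Nat.mul_zero, mul_add (2 * κ + 1), add_zero, add_assoc,
    add_comm ((2 * κ + 1) * n), sub_self, mul_zero, zero_mul]

/-- The recurrence fails termwise, but the discrepancy telescopes: partial sums satisfy it up to one
explicit boundary term, whose exponent is large for large `B`. -/
theorem gordonSum_add_two (q : A) (B s a d : ℕ) :
    gordonSum (a + 1 + d) q B s (a + 2) = gordonSum (a + 1 + d) q B s a + q ^ ((s + 1) * a) *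
      (gordonSum (a + 1 + d) q B (s + 1) (d + 1)
        + q ^ (s + 1) * gordonSum (a + 1 + d) q B (s + 1) d)
      - (-1) ^ B * q ^ (s * (a + 1 + d) * B + (2 * (a + 1 + d) + 1) * B.choose 2
        + (a + 1 + d + d) * B) * (1 - q ^ (2 * B)) * shiftedPochhammer q B s := by
  induction B with
  | zero => simp [gordonSum]
  | succ n ih =>
    simp only [gordonSum_succ]
    have h : (n + 1).choose 2 = n + n.choose 2 := by
      rw [Nat.choose_succ_succ', Nat.choose_one_right]
    have h1 := shiftedPochhammer_succ q n s
    have h2 := shiftedPochhammer_succ' q n s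
    rw [h1] at h2
    simp only [gordonTerm, h, h1,
      show 2 * (a + 1 + d) + 1 - (a + 2) = a + 2 * d + 1 by omega,
      show 2 * (a + 1 + d) + 1 - a = a + 2 * d + 3 by omega,
      show 2 * (a + 1 + d) + 1 - (d + 1) = 2 * a + d + 2 by omega,
      show 2 * (a + 1 + d) + 1 - d = 2 * a + d + 3 by omega]
    generalize shiftedPochhammer q (n + 1) s = P' at *
    generalize shiftedPochhammer q n s = P at *
    generalize n.choose 2 = c at *
    -- `h2` relates the Pochhammer products at `n` and `n + 1`; the factor `1 + q ^ (n + 1)`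
    -- completes its `1 - q ^ (n + 1)` to the `1 - q ^ (2 * (n + 1))` of the new boundary term.
    linear_combination ih + (-1) ^ n * q ^ (s * (a + 1 + d) * (n + 1)
      + (2 * (a + 1 + d) + 1) * (n + c)
        + (a + 1 + d + d) * (n + 1)) * (1 + q ^ (n + 1)) * h2

/-- `seriesD_one` lacks the factor `1 + X ^ (s + 1)` of `seriesD_add_two`, so under the
normalization it appears here on the left. -/
theorem gordonSum_one (κ : ℕ) (q : A) (B s : ℕ) :
    (1 + q ^ (s + 1)) * gordonSum κ q B s 1 =
      gordonSum κ q B (s + 1) (κ + 1) + q ^ (s + 1) * gordonSum κ q B (s + 1) κ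
      - (-1) ^ B * q ^ (s * κ * B + (2 * κ + 1) * B.choose 2 + 2 * κ * B + (s + 1))
        * (1 - q ^ (2 * B)) * shiftedPochhammer q B s := by
  induction B with
  | zero => simp [gordonSum]
  | succ n ih =>
    simp only [gordonSum_succ]
    have h : (n + 1).choose 2 = n + n.choose 2 := by
      rw [Nat.choose_succ_succ', Nat.choose_one_right]
    have h1 := shiftedPochhammer_succ q n s
    have h2 := shiftedPochhammer_succ' q n s
    rw [h1] at h2
    simp only [gordonTerm, h, h1,
      show 2 * κ + 1 - 1 = 2 * κ by omega,
      show 2 * κ + 1 - (κ + 1) = κ by omega,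
      show 2 * κ + 1 - κ = κ + 1 by omega]
    generalize shiftedPochhammer q (n + 1) s = P' at *
    generalize shiftedPochhammer q n s = P at *
    generalize n.choose 2 = c at *
    linear_combination ih + (-1) ^ n * q ^ (s * κ * (n + 1)
      + (2 * κ + 1) * (n + c) + 2 * κ * (n + 1) + (s + 1)) * (1 + q ^ (n + 1)) * h2

end Theta

/-! ### The `q`-binomial theorem and the finite triple product. -/

section TripleProduct
variable {A : Type*} [CommRing A]

/-- The Gaussian binomial coefficient. -/
def gaussBinom (Q : A) : ℕ → ℕ → A
  | _, 0 => 1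
  | 0, _ + 1 => 0
  | n + 1, r + 1 => gaussBinom Q n r + Q ^ (r + 1) * gaussBinom Q n (r + 1)

theorem gaussBinom_zero_right (Q : A) (n : ℕ) : gaussBinom Q n 0 = 1 := by
  cases n <;> rfl

theorem gaussBinom_succ_succ (Q : A) (n r : ℕ) :
    gaussBinom Q (n + 1) (r + 1) = gaussBinom Q n r + Q ^ (r + 1) * gaussBinom Q n (r + 1) := rfl

theorem gaussBinom_eq_zero_of_lt (Q : A) {n r : ℕ} (h : n < r) : gaussBinom Q n r = 0 := by
  induction n generalizing r with
  | zero => obtain ⟨r, rfl⟩ := Nat.exists_eq_succ_of_ne_zero h.ne'; rfl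
  | succ n ih =>
    obtain ⟨r, rfl⟩ := Nat.exists_eq_succ_of_ne_zero (Nat.ne_zero_of_lt h)
    rw [gaussBinom_succ_succ, ih (by omega), ih (by omega), mul_zero, add_zero]

/-- The quotient formula for Gaussian binomials, free of division; Pascal's rule gives it by double
induction. -/
theorem shiftedPochhammer_mul_gaussBinom (Q : A) (r b : ℕ) :
    shiftedPochhammer Q 0 r * gaussBinom Q (r + b) r = shiftedPochhammer Q b r := by
  induction r generalizing b with
  | zero => simp [shiftedPochhammer, gaussBinom_zero_right]
  | succ r ihr =>
    induction b with
    | zero =>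
      have h := ihr 0
      rw [add_zero] at h
      rw [add_zero, gaussBinom_succ_succ, gaussBinom_eq_zero_of_lt Q (Nat.lt_succ_self r),
        mul_zero, add_zero, shiftedPochhammer_succ, mul_right_comm, h]
    | succ b ihb =>
      have h := ihr (b + 1)
      have e1 := shiftedPochhammer_succ Q 0 r
      have e2 := shiftedPochhammer_succ' Q b r
      have e3 := shiftedPochhammer_succ Q (b + 1) r
      have e4 : r + 1 + b = r + (b + 1) := by ring
      rw [← add_assoc, gaussBinom_succ_succ]
      rw [e2, e1, e4, zero_add] at ihb
      rw [e3, e1, e4, zero_add]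
      rw [show b + 1 + r + 1 = (r + 1) + (b + 1) by ring, pow_add]
      linear_combination (1 - Q ^ (r + 1)) * h + Q ^ (r + 1) * ihb

/-- The `q`-binomial theorem. -/
theorem prod_add_mul_pow (u v Q : A) (M : ℕ) :
    ∏ j ∈ Finset.range M, (u + v * Q ^ j)
      = ∑ r ∈ Finset.range (M + 1), gaussBinom Q M r * Q ^ r.choose 2 * v ^ r * u ^ (M - r) := by
  induction M generalizing v with
  | zero => simp [gaussBinom_zero_right]
  | succ M ih =>
    have h1 : ∏ j ∈ Finset.range (M + 1), (u + v * Q ^ j)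
        = (∏ j ∈ Finset.range M, (u + (v * Q) * Q ^ j)) * (u + v) := by
      rw [Finset.prod_range_succ', pow_zero, mul_one]
      simp only [pow_succ', mul_assoc]
    have h2 : u * ∑ r ∈ Finset.range (M + 1),
          gaussBinom Q M r * Q ^ r.choose 2 * (v * Q) ^ r * u ^ (M - r)
        = (∑ r ∈ Finset.range (M + 1),
          Q ^ (r + 1) * gaussBinom Q M (r + 1) * Q ^ (r + 1).choose 2 * v ^ (r + 1) * u ^ (M - r))
          + u ^ (M + 1) := by
      rw [Finset.sum_range_succ', Finset.sum_range_succ _ M, mul_add, Finset.mul_sum,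
        gaussBinom_eq_zero_of_lt Q (Nat.lt_succ_self M)]
      simp only [gaussBinom_zero_right, mul_zero, zero_mul, add_zero, Nat.choose_zero_succ,
        pow_zero, one_mul, Nat.sub_zero, ← pow_succ']
      congr 1
      refine Finset.sum_congr rfl fun r hr => ?_
      have h3 : M - r = M - (r + 1) + 1 := by have := Finset.mem_range.mp hr; omega
      rw [h3]
      ring
    rw [h1, ih, mul_add, mul_comm _ u, h2, mul_comm _ v, Finset.mul_sum,
      Finset.sum_range_succ' _ (M + 1)]
    simp only [gaussBinom_succ_succ, gaussBinom_zero_right, Nat.add_sub_add_right, Nat.sub_zero,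
      Nat.choose_zero_succ, pow_zero, one_mul]
    rw [add_right_comm, ← Finset.sum_add_distrib]
    congr 1
    refine Finset.sum_congr rfl fun r _ => ?_
    have h : (r + 1).choose 2 = r + r.choose 2 := by
      rw [Nat.choose_succ_succ', Nat.choose_one_right]
    rw [h]
    ring

theorem choose_two_add (a b : ℕ) : (a + b).choose 2 = a.choose 2 + b.choose 2 + a * b := by
  induction b with
  | zero => simp
  | succ b ih =>
    rw [← add_assoc, Nat.choose_succ_succ', Nat.choose_one_right, ih, Nat.choose_succ_succ',
      Nat.choose_one_right]
    ring

theorem mul_self_eq_two_mul_choose_add (n : ℕ) : n * n = 2 * n.choose 2 + n := by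
  induction n with
  | zero => rfl
  | succ n ih =>
    rw [Nat.choose_succ_succ', Nat.choose_one_right]
    linarith

theorem prod_range_pow (q : A) (m i N : ℕ) :
    ∏ j ∈ Finset.range N, q ^ (m * j + i) = q ^ (m * N.choose 2 + i * N) := by
  induction N with
  | zero => simp
  | succ N ih =>
    rw [Finset.prod_range_succ, ih, Nat.choose_succ_succ', Nat.choose_one_right]
    ring

/-- The finite form of the Jacobi triple product identity. -/
theorem finite_tripleProduct [IsDomain A] {q : A} (hq : q ≠ 0) {m i : ℕ} (hi : i ≤ m) (N : ℕ) :
    ∏ j ∈ Finset.range N, ((1 - q ^ (m * j + (m - i))) * (1 - q ^ (m * j + i)))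
      = ∑ n ∈ Finset.range (N + 1),
          (-1) ^ n * q ^ (m * n.choose 2 + i * n) * gaussBinom (q ^ m) (2 * N) (N + n)
        + ∑ n ∈ Finset.range N, (-1) ^ (n + 1) * q ^ (m * (n + 1).choose 2 + (m - i) * (n + 1)) *
          gaussBinom (q ^ m) (2 * N) (N - (n + 1)) := by
  -- This monomial clears the negative powers of `q`: it merges the two products into one of `2 * N`
  -- factors, to which the `q`-binomial theorem applies.
  have h0 : (-1) ^ N * q ^ (m * N ^ 2 + m * N.choose 2 + i * N) ≠ 0 :=
    mul_ne_zero (pow_ne_zero _ (neg_ne_zero.mpr one_ne_zero)) (pow_ne_zero _ hq)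
  refine mul_left_cancel₀ h0 ?_
  have hL : (-1) ^ N * q ^ (m * N ^ 2 + m * N.choose 2 + i * N) *
      ∏ j ∈ Finset.range N, ((1 - q ^ (m * j + (m - i))) * (1 - q ^ (m * j + i)))
      = ∏ j ∈ Finset.range (2 * N), (q ^ (m * N) + -q ^ i * (q ^ m) ^ j) := by
    rw [two_mul, Finset.prod_range_add, 
      ← Finset.prod_range_reflect (fun j => q ^ (m * N) + -q ^ i * (q ^ m) ^ j) N]
    have e1 : ∏ j ∈ Finset.range N, (q ^ (m * N) + -q ^ i * (q ^ m) ^ (N - 1 - j))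
        = (-1) ^ N * (∏ j ∈ Finset.range N, q ^ (m * j + i)) *
          ∏ j ∈ Finset.range N, (1 - q ^ (m * j + (m - i))) := by
      have hs : (-1 : A) ^ N = ∏ _j ∈ Finset.range N, (-1) := by simp
      rw [← Finset.prod_range_reflect (fun j => q ^ (m * j + i)), hs, ← Finset.prod_mul_distrib,
        ← Finset.prod_mul_distrib]
      refine Finset.prod_congr rfl fun j hj => ?_
      obtain ⟨c, rfl⟩ := Nat.exists_eq_add_of_lt (Finset.mem_range.mp hj)
      obtain ⟨d, rfl⟩ := Nat.exists_eq_add_of_le hi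
      simp only [show j + c + 1 - 1 - j = c by omega, Nat.add_sub_cancel_left]
      ring
    have e2 : ∏ j ∈ Finset.range N, (q ^ (m * N) + -q ^ i * (q ^ m) ^ (N + j))
        = q ^ (m * N ^ 2) * ∏ j ∈ Finset.range N, (1 - q ^ (m * j + i)) := by
      rw [show m * N ^ 2 = m * N * N by ring, pow_mul q (m * N), ← Finset.card_range N,
        ← Finset.prod_const, Finset.card_range, ← Finset.prod_mul_distrib]
      refine Finset.prod_congr rfl fun j _ => ?_
      ring
    rw [e1, e2, prod_range_pow, Finset.prod_mul_distrib]
    ring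
  -- The indices `r = N + n` give the first sum; the indices `r < N`, reversed, give the second.
  rw [hL, prod_add_mul_pow, show 2 * N + 1 = N + (N + 1) by ring, Finset.sum_range_add,
    add_comm, mul_add, Finset.mul_sum, Finset.mul_sum, ← Finset.sum_range_reflect _ N]
  congr 1
  · refine Finset.sum_congr rfl fun n hn => ?_
    obtain ⟨c, rfl⟩ := Nat.exists_eq_add_of_le (Nat.lt_succ_iff.mp (Finset.mem_range.mp hn))
    rw [show 2 * (n + c) - (n + c + n) = c by omega, choose_two_add (n + c) n, neg_pow (q ^ i)]
    ring
  · refine Finset.sum_congr rfl fun n hn => ?_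
    obtain ⟨c, rfl⟩ := Nat.exists_eq_add_of_lt (Finset.mem_range.mp hn)
    obtain ⟨d, rfl⟩ := Nat.exists_eq_add_of_le hi
    have hc : (n + 1).choose 2 = n + n.choose 2 := by
      rw [Nat.choose_succ_succ', Nat.choose_one_right]
    rw [show n + c + 1 - 1 - n = c by omega, show n + c + 1 - (n + 1) = c by omega,
      show 2 * (n + c + 1) - c = 2 * n + c + 2 by omega, Nat.add_sub_cancel_left,
      show n + c + 1 = c + (n + 1) by ring, choose_two_add c (n + 1), neg_pow (q ^ i)]
    have hs : (-1 : A) ^ (c + (n + 1)) * (-1) ^ (n + 1) = (-1) ^ c := by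
      rw [pow_add, mul_assoc, ← mul_pow]; simp
    have hn2 := mul_self_eq_two_mul_choose_add n
    have he : (i + d) * (c + (n + 1)) ^ 2 + (i + d) * (c.choose 2 + (n + 1).choose 2 + c * (n + 1))
        + i * (c + (n + 1)) + ((i + d) * (n + 1).choose 2 + d * (n + 1))
        = (i + d) * c.choose 2 + i * c + (i + d) * (c + (n + 1)) * (2 * n + c + 2) := by
      rw [hc]
      linear_combination (i + d) * (-hn2)
    have he' := congrArg (fun e => q ^ e) he
    generalize gaussBinom (q ^ (i + d)) (2 * (c + (n + 1))) c = g
    linear_combination (-g * (-1) ^ c) * he' - g * q ^ ((i + d) * (c + (n + 1)) ^ 2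
      + (i + d) * (c.choose 2 + (n + 1).choose 2 + c * (n + 1))
        + i * (c + (n + 1)) + ((i + d) * (n + 1).choose 2 + d * (n + 1))) * hs

end TripleProduct

/-! ### The triple product to a given order, and its residue classes. -/

section TripleProductLimit
variable {A : Type*} [CommRing A]

theorem pow_dvd_shiftedPochhammer_sub_one (Q : A) (b r : ℕ) :
    Q ^ (b + 1) ∣ shiftedPochhammer Q b r - 1 := by
  induction r with
  | zero => simp [shiftedPochhammer]
  | succ r ih =>
    have h : shiftedPochhammer Q b (r + 1) - 1
        = (shiftedPochhammer Q b r - 1) - Q ^ (b + 1) * (Q ^ r * shiftedPochhammer Q b r) := by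
      rw [shiftedPochhammer_succ]; ring
    rw [h]
    exact dvd_sub ih (dvd_mul_right _ _)

theorem shiftedPochhammer_add (Q : A) (b r t : ℕ) :
    shiftedPochhammer Q b (r + t) = shiftedPochhammer Q b r * shiftedPochhammer Q (b + r) t := by
  rw [shiftedPochhammer, Finset.prod_range_add, shiftedPochhammer, shiftedPochhammer]
  congr 1
  exact Finset.prod_congr rfl fun j _ => by congr 2; ring

/-- Times `shiftedPochhammer Q (n + c) n`, itself `1` to this order, the product becomes
`shiftedPochhammer Q c (n + c + n)`. -/
theorem pow_dvd_pochhammer_mul_gaussBinom_add (Q : A) (n c : ℕ) :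
    Q ^ (c + 1) ∣ shiftedPochhammer Q 0 (n + c) *
      gaussBinom Q (2 * (n + c)) (n + c + n) - 1 := by
  have h1 := shiftedPochhammer_mul_gaussBinom Q (n + c + n) c
  rw [show n + c + n + c = 2 * (n + c) by ring, shiftedPochhammer_add, zero_add] at h1
  have h2 := pow_dvd_shiftedPochhammer_sub_one Q c (n + c + n)
  have h3 := (pow_dvd_pow Q (show c + 1 ≤ n + c + 1 by omega)).trans
    (pow_dvd_shiftedPochhammer_sub_one Q (n + c) n)
  have h4 := dvd_sub h2 (h3.mul_left
    (shiftedPochhammer Q 0 (n + c) * gaussBinom Q (2 * (n + c)) (n + c + n)))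
  rw [← h1] at h4
  convert h4 using 1
  ring

theorem pow_dvd_pochhammer_mul_gaussBinom_sub (Q : A) (n c : ℕ) :
    Q ^ (c + 1) ∣ shiftedPochhammer Q 0 (n + c) * gaussBinom Q (2 * (n + c)) c - 1 := by
  have h1 := shiftedPochhammer_mul_gaussBinom Q c (c + 2 * n)
  have h2 := (pow_dvd_pow Q (show c + 1 ≤ c + 2 * n + 1 by omega)).trans
    (pow_dvd_shiftedPochhammer_sub_one Q (c + 2 * n) c)
  have h3 := pow_dvd_shiftedPochhammer_sub_one Q c n
  have h4 := dvd_add (h2.mul_right (shiftedPochhammer Q c n)) h3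
  rw [← h1] at h4
  convert h4 using 1
  rw [show n + c = c + n by ring, shiftedPochhammer_add, zero_add,
    show c + (c + 2 * n) = 2 * (c + n) by ring]
  ring

/-- With `N = n + c`, the weight of the `n`-th theta term makes up for the precision lost in the
Gaussian binomial near the edge. -/
theorem le_triangular_exponent {m a : ℕ} (hm : 0 < m) (ha : 0 < a) (n c : ℕ) :
    n + c + 1 ≤ m * n.choose 2 + a * n + m * (c + 1) := by
  cases n with
  | zero => simp only [Nat.zero_add, Nat.mul_zero, Nat.choose_zero_succ]; nlinarith
  | succ n =>
    rw [Nat.choose_succ_succ', Nat.choose_one_right]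
    nlinarith [Nat.zero_le (m * (n + 1).choose 2), Nat.zero_le (m * n.choose 2),
      Nat.mul_le_mul hm (le_refl (n + c + 1)), Nat.mul_le_mul ha (le_refl (n + 1))]

/-- The Jacobi triple product identity up to order `N`. -/
theorem tripleProduct_dvd [IsDomain A] {q : A} (hq : q ≠ 0) {κ i : ℕ} (hi : 0 < i)
    (hik : i < 2 * κ + 1) (N : ℕ) :
    q ^ (N + 1) ∣ shiftedPochhammer (q ^ (2 * κ + 1)) 0 N *
        ∏ j ∈ Finset.range N, ((1 - q ^ ((2 * κ + 1) * j + i)) *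
          (1 - q ^ ((2 * κ + 1) * j + (2 * κ + 1 - i))))
      - gordonSum κ q (N + 1) 0 i := by
  have hG : gordonSum κ q (N + 1) 0 i
      = (∑ n ∈ Finset.range (N + 1),
          (-1) ^ n * q ^ ((2 * κ + 1) * n.choose 2 + (2 * κ + 1 - i) * n)) +
        ((∑ n ∈ Finset.range N,
          (-1) ^ (n + 1) * q ^ ((2 * κ + 1) * (n + 1).choose 2 + i * (n + 1)))
        + (-1) ^ (N + 1) * q ^ ((2 * κ + 1) * (N + 1).choose 2 + i * (N + 1))) := by
    rw [← Finset.sum_range_succ (fun n => (-1) ^ (n + 1) *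
      q ^ ((2 * κ + 1) * (n + 1).choose 2 + i * (n + 1))), ← Finset.sum_add_distrib]
    refine Finset.sum_congr rfl fun n _ => ?_
    simp only [gordonTerm, shiftedPochhammer, Finset.range_zero, Finset.prod_empty, zero_mul,
      zero_add]
    ring
  have hJ := finite_tripleProduct hq (Nat.sub_le (2 * κ + 1) i) N
  rw [Nat.sub_sub_self hik.le] at hJ
  rw [hG, hJ]
  generalize hm : 2 * κ + 1 = m at *
  have hm0 : 0 < m := by omega
  rw [mul_add, Finset.mul_sum, Finset.mul_sum, add_sub_add_comm, ← sub_sub,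
    ← Finset.sum_sub_distrib, ← Finset.sum_sub_distrib]
  refine dvd_add (Finset.dvd_sum fun n hn => ?_) (dvd_sub (Finset.dvd_sum fun n hn => ?_) ?_)
  · obtain ⟨c, rfl⟩ := Nat.exists_eq_add_of_le (Nat.lt_succ_iff.mp (Finset.mem_range.mp hn))
    have h := mul_dvd_mul (dvd_refl (q ^ (m * n.choose 2 + (m - i) * n)))
      (pow_dvd_pochhammer_mul_gaussBinom_add (q ^ m) n c)
    rw [← pow_mul, ← pow_add] at h
    refine (((pow_dvd_pow q (le_triangular_exponent hm0 (Nat.sub_pos_of_lt hik) n c)).trans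
      h).mul_left ((-1) ^ n)).trans (dvd_of_eq ?_)
    ring
  · obtain ⟨c, rfl⟩ := Nat.exists_eq_add_of_lt (Finset.mem_range.mp hn)
    have h := mul_dvd_mul (dvd_refl (q ^ (m * (n + 1).choose 2 + i * (n + 1))))
      (pow_dvd_pochhammer_mul_gaussBinom_sub (q ^ m) (n + 1) c)
    rw [← pow_mul, ← pow_add] at h
    refine (((pow_dvd_pow q ((show n + c + 1 + 1 ≤ n + 1 + c + 1 by omega).trans
      (le_triangular_exponent hm0 hi (n + 1) c))).trans
      h).mul_left ((-1) ^ (n + 1))).trans (dvd_of_eq ?_)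
    rw [show n + c + 1 - (n + 1) = c by omega, show n + 1 + c = n + c + 1 by ring]
    ring
  -- The second exponential of the last term of `gordonSum` has no partner in the finite identity,
  -- but its order exceeds `N`.
  · refine ((pow_dvd_pow q ?_).mul_left _)
    nlinarith [Nat.zero_le (m * (N + 1).choose 2), Nat.mul_le_mul hi (le_refl (N + 1))]

/-- The residue condition on `l` in the definition of `Overpartition.IsC`. -/
abbrev SpecialResidue (k i l : ℕ) : Prop :=
  (l : ℤ) ≡ 0 [ZMOD 2 * (k : ℤ) - 1] ∨ (l : ℤ) ≡ (i : ℤ) [ZMOD 2 * (k : ℤ) - 1] ∨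
    (l : ℤ) ≡ -(i : ℤ) [ZMOD 2 * (k : ℤ) - 1]

theorem int_modEq_iff_eq {m t c : ℤ} (ht : 0 < t) (htm : t ≤ m) (hc : 0 < c) (hcm : c ≤ m) :
    t ≡ c [ZMOD m] ↔ t = c := by
  refine ⟨fun h => ?_, fun h => h ▸ Int.ModEq.refl _⟩
  have := Int.eq_zero_of_abs_lt_dvd h.dvd (by rw [abs_lt]; constructor <;> linarith)
  linarith

theorem specialResidue_iff {κ i r : ℕ} (N : ℕ) (hi : 0 < i) (hik : i < 2 * κ + 1)
    (hr : r < 2 * κ + 1) :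
    SpecialResidue (κ + 1) i ((2 * κ + 1) * N + r + 1) ↔
      r = 2 * κ ∨ r = i - 1 ∨ r = 2 * κ - i := by
  have hm : 2 * ((κ + 1 : ℕ) : ℤ) - 1 = 2 * κ + 1 := by push_cast; ring
  have h1 : ∀ c c' : ℤ, (c' = c ∨ c' = c + (2 * κ + 1)) → 0 < c' → c' ≤ 2 * κ + 1 →
      ((((2 * κ + 1) * N + r + 1 : ℕ) : ℤ) ≡ c [ZMOD 2 * κ + 1] ↔ (r : ℤ) + 1 = c') := by
    intro c c' h hc hc'
    rw [← int_modEq_iff_eq (m := 2 * κ + 1) (by omega) (by omega) hc hc']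
    have e1 : (r : ℤ) + 1 ≡ (((2 * κ + 1) * N + r + 1 : ℕ) : ℤ) [ZMOD 2 * κ + 1] :=
      Int.modEq_iff_dvd.mpr ⟨N, by push_cast; ring⟩
    have e2 : c ≡ c' [ZMOD 2 * κ + 1] := by
      rcases h with rfl | rfl
      · rfl
      · exact Int.modEq_iff_dvd.mpr ⟨1, by ring⟩
    exact ⟨fun h => (e1.trans h).trans e2, fun h => (e1.symm.trans h).trans e2.symm⟩
  rw [SpecialResidue, hm, h1 0 (2 * κ + 1) (by omega) (by omega) (by omega),
    h1 i i (by omega) (by omega) (by omega),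
    h1 (-i) (2 * κ + 1 - i) (by omega) (by omega) (by omega)]
  omega

open Classical in
theorem prod_specialResidue (q : A) {κ i : ℕ} (hi : 0 < i) (hik : i < 2 * κ + 1) (N : ℕ) :
    ∏ t ∈ Finset.range ((2 * κ + 1) * N),
        (if SpecialResidue (κ + 1) i (t + 1) then 1 - q ^ (t + 1) else 1)
      = shiftedPochhammer (q ^ (2 * κ + 1)) 0 N *
        ∏ j ∈ Finset.range N, ((1 - q ^ ((2 * κ + 1) * j + i)) *
          (1 - q ^ ((2 * κ + 1) * j + (2 * κ + 1 - i)))) := by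
  induction N with
  | zero => simp [shiftedPochhammer]
  | succ N ih =>
    have h : ∏ r ∈ Finset.range (2 * κ + 1),
        (if SpecialResidue (κ + 1) i ((2 * κ + 1) * N + r + 1)
          then 1 - q ^ ((2 * κ + 1) * N + r + 1) else 1)
        = ∏ r ∈ {2 * κ, i - 1, 2 * κ - i}, (1 - q ^ ((2 * κ + 1) * N + r + 1)) := by
      symm
      rw [← Finset.prod_filter]
      refine Finset.prod_congr ?_ fun _ _ => rfl
      ext r
      simp only [Finset.mem_insert, Finset.mem_singleton, Finset.mem_filter, Finset.mem_range]
      constructor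
      · intro hr
        have hr' : r < 2 * κ + 1 := by omega
        exact ⟨hr', (specialResidue_iff N hi hik hr').mpr hr⟩
      · rintro ⟨hr', hr⟩
        exact (specialResidue_iff N hi hik hr').mp hr
    rw [Nat.mul_succ, Finset.prod_range_add, ih, h, Finset.prod_insert, Finset.prod_insert,
      Finset.prod_singleton, Finset.prod_range_succ, shiftedPochhammer_succ, ← pow_mul,
      show (2 * κ + 1) * N + (i - 1) + 1 = (2 * κ + 1) * N + i by omega,
      show (2 * κ + 1) * N + (2 * κ - i) + 1 = (2 * κ + 1) * N + (2 * κ + 1 - i) by omega,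
      show (2 * κ + 1) * (0 + N + 1) = (2 * κ + 1) * N + 2 * κ + 1 by ring]
    · ring
    -- The classes of `i` and `-i` differ because the modulus is odd.
    · simp only [Finset.mem_singleton]; omega
    · simp only [Finset.mem_insert, Finset.mem_singleton]; omega

end TripleProductLimit

/-! ### Comparison of the two series modulo a power of `X`. -/

section Comparison
variable {A : Type*} [CommRing A]

theorem map_eq_one_of_dvd {φ : ℤ⟦X⟧ →+* A} {N : ℕ} (hN : φ X ^ (N + 1) = 0) {f : ℤ⟦X⟧}
    (h : X ^ (N + 1) ∣ f - 1) : φ f = 1 := by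
  obtain ⟨g, hg⟩ := h
  rw [sub_eq_iff_eq_add.mp hg, map_add, map_mul, map_pow, hN, zero_mul, zero_add, map_one]

theorem pow_eq_zero_of_lt {q : A} {N e : ℕ} (hN : q ^ (N + 1) = 0) (h : N < e) : q ^ e = 0 :=
  pow_eq_zero_of_le h hN

/-- At level `s = N` every exponent exceeds `N` except the exponent `0` in the term `n = 0`. -/
theorem gordonSum_eq_shiftedPochhammer {q : A} {κ i N : ℕ} (hκ : 0 < κ) (hi : 0 < i)
    (hik : i ≤ κ + 1) (hN : q ^ (N + 1) = 0) :
    gordonSum κ q (N + 1) N i = shiftedPochhammer q 0 N := by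
  rw [gordonSum, Finset.sum_range_succ', Finset.sum_eq_zero, zero_add, gordonTerm,
    pow_eq_zero_of_lt hN (e := _ + (N + 0 + 1) * i)]
  · simp
  · nlinarith [Nat.mul_le_mul_left (N + 1) hi]
  · intro n _
    rw [gordonTerm, pow_eq_zero_of_lt hN, pow_eq_zero_of_lt hN, sub_zero, mul_zero, zero_mul]
    · nlinarith [Nat.mul_le_mul_left (N + (n + 1) + 1) hi, Nat.zero_le (N * κ * (n + 1)),
        Nat.zero_le ((2 * κ + 1) * (n + 1 + 1).choose 2)]
    · have h1 : 1 ≤ 2 * κ + 1 - i := by omega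
      have h2 := Nat.mul_le_mul (Nat.mul_le_mul_left N hκ) (Nat.le_add_left 1 n)
      have h3 := Nat.mul_le_mul h1 (Nat.le_add_left 1 n)
      rw [Nat.succ_eq_add_one, zero_add, mul_one, mul_one] at h2
      have := Nat.zero_le ((2 * κ + 1) * (n + 1).choose 2)
      omega

theorem gordonSum_add_two_of_pow_eq_zero {q : A} {κ a d N s : ℕ} (hd : d + (a + 2) = κ + 1)
    (hN : q ^ (N + 1) = 0) :
    gordonSum κ q (N + 1) s (a + 2) = gordonSum κ q (N + 1) s a + q ^ ((s + 1) * a) *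
      (gordonSum κ q (N + 1) (s + 1) (d + 1) + q ^ (s + 1) * gordonSum κ q (N + 1) (s + 1) d) := by
  obtain rfl : κ = a + 1 + d := by omega
  rw [gordonSum_add_two, pow_eq_zero_of_lt hN (e := _ + (a + 1 + d + d) * (N + 1)), mul_zero, zero_mul, zero_mul, sub_zero]
  have h := Nat.mul_le_mul_right (N + 1) (show 1 ≤ a + 1 + d + d by omega)
  exact Nat.lt_of_lt_of_le (by omega) (Nat.le_add_left _ _)

theorem gordonSum_one_of_pow_eq_zero {q : A} {κ N s : ℕ} (hκ : 0 < κ) (hN : q ^ (N + 1) = 0) :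
    (1 + q ^ (s + 1)) * gordonSum κ q (N + 1) s 1 =
      gordonSum κ q (N + 1) (s + 1) (κ + 1)
        + q ^ (s + 1) * gordonSum κ q (N + 1) (s + 1) κ := by
  rw [gordonSum_one, pow_eq_zero_of_lt hN (e := _ + 2 * κ * (N + 1) + (s + 1)), mul_zero, zero_mul, zero_mul, sub_zero]
  have h := Nat.mul_le_mul_right (N + 1) (show 1 ≤ 2 * κ by omega)
  omega

theorem isUnit_one_add_pow {q : A} {N : ℕ} (hN : q ^ (N + 1) = 0) (j : ℕ) :
    IsUnit (1 + q ^ (j + 1)) :=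
  IsNilpotent.isUnit_one_add ⟨N + 1, by rw [← pow_mul, mul_comm, pow_mul, hN, zero_pow (by omega)]⟩

theorem isUnit_shiftedPochhammer {q : A} {N : ℕ} (hN : q ^ (N + 1) = 0) (n s : ℕ) :
    IsUnit (shiftedPochhammer q n s) := by
  refine IsUnit.prod_iff.mpr fun j _ => ?_
  refine IsNilpotent.isUnit_one_sub ⟨N + 1, ?_⟩
  rw [← pow_mul, mul_comm, pow_mul, hN, zero_pow (by omega)]

/-- Downward induction on the level through `t = N - s`; at each level, strong induction on `i` in
steps of two, ending at `0` or `1`. -/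
theorem map_seriesD {φ : ℤ⟦X⟧ →+* A} {κ N : ℕ} (hκ : 0 < κ) (hN : φ X ^ (N + 1) = 0)
    (t s : ℕ) (hst : s + t = N) (i : ℕ) (hik : i ≤ κ + 1) :
    shiftedPochhammer (φ X) 0 N * (∏ j ∈ Finset.range s, (1 + φ X ^ (j + 1))) *
        φ (OverPair.seriesD κ s i)
      = (∏ j ∈ Finset.range N, (1 + φ X ^ (j + 1))) * gordonSum κ (φ X) (N + 1) s i := by
  induction t generalizing s i with
  | zero =>
    obtain rfl : s = N := hst
    rcases Nat.eq_zero_or_pos i with rfl | hi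
    · rw [OverPair.seriesD_zero, gordonSum_zero, map_zero, mul_zero, mul_zero]
    · rw [map_eq_one_of_dvd hN (OverPair.X_pow_dvd_seriesD_sub_one hκ hi),
        gordonSum_eq_shiftedPochhammer hκ hi hik hN]
      ring
  | succ t iht =>
    have ih := iht (s + 1) (by omega)
    rw [Finset.prod_range_succ] at ih
    induction i using Nat.strong_induction_on with
    | _ i ihi =>
      match i, ihi with
      | 0, _ => rw [OverPair.seriesD_zero, gordonSum_zero, map_zero, mul_zero, mul_zero]
      | 1, _ =>
        -- The extra factor from `gordonSum_one` can be cancelled because `φ X` is nilpotent.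
        refine (isUnit_one_add_pow hN s).mul_left_cancel ?_
        have h1 := ih (κ + 1) le_rfl
        have h2 := ih κ (Nat.le_succ κ)
        have h3 := gordonSum_one_of_pow_eq_zero (s := s) hκ hN
        rw [OverPair.seriesD_one]
        simp only [map_add, map_mul, map_pow]
        linear_combination h1 + φ X ^ (s + 1) * h2
          - (∏ j ∈ Finset.range N, (1 + φ X ^ (j + 1))) * h3
      | a + 2, ihi =>
        obtain ⟨d, hd⟩ := Nat.exists_eq_add_of_le' hik
        have h0 := ihi a (by omega) (by omega)
        have h1 := ih (d + 1) (by omega)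
        have h2 := ih d (by omega)
        have h3 := gordonSum_add_two_of_pow_eq_zero (s := s) hd.symm hN
        rw [OverPair.seriesD_add_two hd.symm, h3]
        simp only [map_add, map_mul, map_pow, map_one]
        linear_combination h0 + φ X ^ ((s + 1) * a) * (h1 + φ X ^ (s + 1) * h2)

open Classical in
theorem map_seriesC {φ : ℤ⟦X⟧ →+* A} {N : ℕ} (hN : φ X ^ (N + 1) = 0) (F : ℕ → Prop)
    (t s : ℕ) (hst : s + t = N) :
    shiftedPochhammer (φ X) s t * φ (OverPair.seriesC F s)
      = (∏ j ∈ Finset.range t, (1 + φ X ^ (s + j + 1))) *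
        ∏ j ∈ Finset.range t, (if F (s + j + 1) then 1 - φ X ^ (s + j + 1) else 1) := by
  induction t generalizing s with
  | zero =>
    obtain rfl : s = N := hst
    rw [map_eq_one_of_dvd hN OverPair.X_pow_dvd_seriesC_sub_one]
    simp [shiftedPochhammer]
  | succ t iht =>
    have ih := iht (s + 1) (by omega)
    have e : ∀ j, s + (j + 1) + 1 = s + 1 + j + 1 := fun j => by ring
    rw [shiftedPochhammer_succ', Finset.prod_range_succ', Finset.prod_range_succ' _ t]
    simp only [e, add_zero]
    by_cases hF : F (s + 1)
    · have h := congrArg φ (OverPair.seriesC_of_pos hF)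
      simp only [map_add, map_mul, map_pow, map_one] at h
      rw [h, if_pos hF]
      linear_combination (1 - φ X ^ (s + 1)) * (1 + φ X ^ (s + 1)) * ih
    · have h := congrArg φ (OverPair.seriesC_of_neg hF)
      simp only [map_add, map_sub, map_mul, map_pow, map_one] at h
      rw [if_neg hF]
      linear_combination shiftedPochhammer (φ X) (s + 1) t * h + (1 + φ X ^ (s + 1)) * ih

theorem map_shiftedPochhammer {B : Type*} [CommRing B] (φ : A →+* B) (q : A) (n s : ℕ) :
    φ (shiftedPochhammer q n s) = shiftedPochhammer (φ q) n s := by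
  simp [shiftedPochhammer]

theorem map_gordonSum {B : Type*} [CommRing B] (φ : A →+* B) (κ : ℕ) (q : A) (M s i : ℕ) :
    φ (gordonSum κ q M s i) = gordonSum κ (φ q) M s i := by
  simp [gordonSum, gordonTerm, map_shiftedPochhammer]

open Classical in
theorem gordonSum_eq_prod {φ : ℤ⟦X⟧ →+* A} {κ i N : ℕ} (hi : 0 < i) (hik : i < 2 * κ + 1)
    (hN : φ X ^ (N + 1) = 0) :
    gordonSum κ (φ X) (N + 1) 0 i = ∏ t ∈ Finset.range N,
      (if SpecialResidue (κ + 1) i (t + 1) then 1 - φ X ^ (t + 1) else 1) := by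
  obtain ⟨g, hg⟩ := tripleProduct_dvd (q := (X : ℤ⟦X⟧)) X_ne_zero hi hik N
  rw [← prod_specialResidue X hi hik] at hg
  have h := congrArg φ hg
  rw [map_sub, map_mul, map_pow, hN, zero_mul, sub_eq_zero, map_gordonSum, map_prod] at h
  rw [← h, ← Finset.prod_subset (s₁ := Finset.range N)]
  · refine Finset.prod_congr rfl fun t _ => ?_
    split_ifs <;> simp
  · exact Finset.range_mono (Nat.le_mul_of_pos_left N (by omega))
  -- The triple product runs to `(2 * κ + 1) * N`, but its factors beyond `N` become `1`.
  · intro t _ ht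
    rw [Finset.mem_range, not_lt] at ht
    split_ifs
    · rw [map_sub, map_pow, pow_eq_zero_of_lt hN (by omega), map_one, sub_zero]
    · exact map_one φ

end Comparison

theorem theorem2p1 (k i n : ℕ) (hk : 2 ≤ k) (hi : 1 ≤ i) (hik : i ≤ k) :
    countC k i n = countD k i n := by
  obtain ⟨κ, rfl⟩ : ∃ κ, k = κ + 1 := ⟨k - 1, by omega⟩
  have hκ : 0 < κ := by omega
  -- Truncation at order `n + 1` keeps the coefficient of `X ^ n`.
  let φ : ℤ⟦X⟧ →+* ℤ⟦X⟧ ⧸ Ideal.span {(X : ℤ⟦X⟧) ^ (n + 1)} := Ideal.Quotient.mk _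
  have hN : φ X ^ (n + 1) = 0 := by
    rw [← map_pow]
    exact Ideal.Quotient.eq_zero_iff_mem.mpr (Ideal.mem_span_singleton_self _)
  have hD := map_seriesD hκ hN n 0 (zero_add n) i hik
  have hC := map_seriesC hN (SpecialResidue (κ + 1) i) n 0 (zero_add n)
  rw [gordonSum_eq_prod hi (by omega) hN, Finset.range_zero, Finset.prod_empty, mul_one] at hD
  simp only [zero_add] at hC
  have h := (isUnit_shiftedPochhammer hN 0 n).mul_left_cancel (hC.trans hD.symm)
  have h2 : X ^ (n + 1) ∣ OverPair.seriesC (SpecialResidue (κ + 1) i) 0 - OverPair.seriesD κ 0 i :=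
    Ideal.mem_span_singleton.mp (Ideal.Quotient.eq.mp h)
  have h3 := X_pow_dvd_iff.mp h2 n (Nat.lt_succ_self n)
  rw [map_sub, sub_eq_zero] at h3
  have h4 : (countC (κ + 1) i n : ℤ) = countD (κ + 1) i n := by
    rw [OverPair.countC_eq_coeff, OverPair.countD_eq_coeff hi hik, ← h3]
  exact_mod_cast h4
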